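/- Let $d\in\mathbb N$, $\rho>0$, and let $L:\mathbb R\to\mathbb R^{d\times d}$ be locally integrable. For $s\in\mathbb R$ let $\Psi(\cdot,s)$ be the principal matrix solution of $\dot x=L(t)x$ at $s$, i.e. the continuous solution of $\Psi(t,s)=\mathrm{Id}+\int_s^tL(r)\Psi(r,s)\,dr$, $t\in\mathbb R$. Assume that $\dot x=L(t)x$ is exponentially stable: there are $K\ge 1$ and $\gamma>0$ with $\|\Psi(t,s)\|\le Ke^{-\gamma(t-s)}$ for all $t\ge s$ (operator norm induced by the Euclidean norm). Let $\mathcal U=\{\xi\in L^\infty(\mathbb R,\mathbb R^d): \|\xi\|_\infty\le 1\}$. For $M\subset\mathbb R^d$ and $t_0<t$ let $\Phi^{t,t_0}(M)$ be the set of all $x(t)$, where $x$ is a (Carathéodory) solution of $\dot x=L(t)x+\rho\,\xi(t)$ with $x(t_0)\in M$ and $\xi\in\mathcal U$; this is the two-parameter semigroup induced by the differential inclusion $\dot x\in\overline B_\rho(L(t)x)$. A family $\mathcal M=(M_t)_{t\in\mathbb R}$ of nonempty compact subsets of $\mathbb R^d$ is called invariant if $\Phi^{t,t_0}(M_{t_0})=M_t$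 for all $t_0<t$; it is called minimal invariant if, moreover, every invariant family $(S_t)_{t\in\mathbb R}$ with $S_t\subset M_t$ for all $t$ is equal to $\mathcal M$; it is called uniformly bounded if there is $r>0$ with $M_t\subset B_r(0)$ for all $t$. Then the integrals in $$A_t=\Big\{\rho\int_{-\infty}^t\Psi(t,s)\xi(s)\,ds \;:\; \xi\in\mathcal U\Big\},\qquad t\in\mathbb R,$$ converge absolutely, the family $\mathcal A=(A_t)_{t\in\mathbb R}$ is uniformly bounded and minimal invariant, and it is the only uniformly bounded minimal invariant family. Moreover, for every nonempty compact set $C\subset\mathbb R^d$, with $h$ the Hausdorff distance, $$\lim_{t_0\to-\infty}h\big(\Phi^{t,t_0}(C),A_t\big)=0\ \text{ for all }t\in\mathbb R,\qquad \lim_{t\to\infty}h\big(\Phi^{t,t_0}(C),A_t\big)=0\ \text{ for all }t_0\in\mathbb R.$$ -/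

import Mathlib

open MeasureTheory Filter Topology

noncomputable section

namespace LinearInclusion

/-- The Euclidean space `ℝ^d`. -/
abbrev E (d : ℕ) : Type := EuclideanSpace ℝ (Fin d)

/-- Real `d × d` matrices, as linear operators of Euclidean space. The norm is the induced norm
`‖A‖ = sup {|A x| : |x| = 1}`. -/
abbrev Op (d : ℕ) : Type := E d →L[ℝ] E d

variable {d : ℕ}

/-- `X` is the (Carathéodory) solution on `ℝ` of the matrix problem `X' = L(t) X`, `X(s) = Id`. -/
def IsPrincipalSolutionAt (L : ℝ → Op d) (s : ℝ) (X : ℝ → Op d) : Prop :=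
  Continuous X ∧ ∀ t, X t = ContinuousLinearMap.id ℝ (E d) + ∫ r in s..t, (L r).comp (X r)

/-- The principal matrix solution `Ψ(t,s)` of `x' = L(t) x` at `s`. -/
def principalSolution (L : ℝ → Op d) (t s : ℝ) : Op d :=
  Classical.epsilon (fun X : ℝ → Op d => IsPrincipalSolutionAt L s X) t

/-- `x' = L(t) x` is exponentially stable. -/
def ExponentiallyStable (L : ℝ → Op d) : Prop :=
  ∃ K γ : ℝ, 1 ≤ K ∧ 0 < γ ∧
    ∀ s t : ℝ, s ≤ t → ‖principalSolution L t s‖ ≤ K * Real.exp (-γ * (t - s))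

/-- The admissible controls: `ξ ∈ L^∞(ℝ, ℝ^d)` with `‖ξ‖_∞ ≤ 1`. -/
def controls (d : ℕ) : Set (ℝ → E d) :=
  {ξ | MemLp ξ ⊤ volume ∧ eLpNorm ξ ⊤ volume ≤ 1}

/-- `x` is the Carathéodory solution on `ℝ` of `x' = L(t) x + ρ ξ(t)`, `x(t₀) = x₀`. -/
def IsSolution (L : ℝ → Op d) (ρ : ℝ) (ξ : ℝ → E d) (t₀ : ℝ) (x₀ : E d) (x : ℝ → E d) : Prop :=
  Continuous x ∧ ∀ t, x t = x₀ + ∫ r in t₀..t, (L r (x r) + ρ • ξ r)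

/-- The set-valued evolution operator `Φ^{t,t₀}`: all points reached at time `t` from points of
`M` at time `t₀` by solutions of `x' = L(t) x + ρ ξ(t)` for admissible `ξ`. -/
def evolution (L : ℝ → Op d) (ρ t t₀ : ℝ) (M : Set (E d)) : Set (E d) :=
  {y | ∃ x₀ ∈ M, ∃ ξ ∈ controls d, ∃ x : ℝ → E d, IsSolution L ρ ξ t₀ x₀ x ∧ x t = y}

/-- Uniform boundedness of a nonautonomous set `(M_t)`. -/
def UniformlyBounded (M : ℝ → Set (E d)) : Prop :=
  ∃ r : ℝ, 0 < r ∧ ∀ t, M t ⊆ Metric.ball 0 r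

/-- An invariant set: nonempty and compact fibres with `Φ^{t,t₀}(M_{t₀}) = M_t` for `t₀ < t`. -/
def IsInvariant (L : ℝ → Op d) (ρ : ℝ) (M : ℝ → Set (E d)) : Prop :=
  (∀ t, (M t).Nonempty) ∧ (∀ t, IsCompact (M t)) ∧
    ∀ t₀ t : ℝ, t₀ < t → evolution L ρ t t₀ (M t₀) = M t

/-- A minimal invariant set: no proper (nonempty, closed) subset is invariant. -/
def IsMinimalInvariant (L : ℝ → Op d) (ρ : ℝ) (M : ℝ → Set (E d)) : Prop :=
  IsInvariant L ρ M ∧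
    ∀ S : ℝ → Set (E d), IsInvariant L ρ S → (∀ t, S t ⊆ M t) → S = M

/-- `A_t = {ρ ∫_{-∞}^t Ψ(t,s) ξ(s) ds : ‖ξ‖_∞ ≤ 1}`. -/
def attractor (L : ℝ → Op d) (ρ t : ℝ) : Set (E d) :=
  {x | ∃ ξ ∈ controls d, x = ρ • ∫ s in Set.Iic t, principalSolution L t s (ξ s)}

end LinearInclusion

end

/-! By variation of constants, a point reached at time `t` from `x₀` has the form `Ψ(t,t₀)x₀ +
ρ∫_{t₀}^t Ψ(t,s)ξ(s) ds`. Splitting the integral over `(-∞,t]` at `t₀` and gluing controls there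
gives `Φ^{t,t₀}(A_{t₀}) = A_t` (`evolution_attractor`).

Two solutions driven by the same control differ by `Ψ(t,t₀)(x₀ - x₀')`. Hence `Φ^{t,t₀}` brings any
two nonempty sets in the ball of radius `R` within Hausdorff distance `2RKe^{-γ(t-t₀)}`
(`hausdorffEDist_evolution_le`). Comparison with `A_{t₀}` yields both attraction statements. For a
uniformly bounded invariant family, `t₀ → -∞` forces equality with `A`
(`eq_attractor_of_isInvariant`), which gives uniqueness and minimality together.

Two points need analysis. As `L` is only locally integrable, `Ψ` is built from the Peano–Baker
series, and derivatives are replaced by a product rule for indefinite integrals, proved by Fubini.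
Compactness of `A_t` comes from a weighted `L²` space, where bounded closed convex sets have closed
images under continuous linear maps. -/

noncomputable section

namespace LinearInclusion

/-! ### Product rule for indefinite integrals -/

section ProductRule

variable {F G H : Type*} [NormedAddCommGroup F] [NormedSpace ℝ F] [NormedAddCommGroup G]
  [NormedSpace ℝ G] [NormedAddCommGroup H] [NormedSpace ℝ H]

theorem integrable_bilin_prod (B : F →L[ℝ] G →L[ℝ] H) {μ : Measure ℝ} [SFinite μ]
    {f : ℝ → F} {g : ℝ → G} (hf : Integrable f μ) (hg : Integrable g μ) :
    Integrable (fun z : ℝ × ℝ => B (f z.1) (g z.2)) (μ.prod μ) := by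
  refine Integrable.mono' ((hf.norm.mul_prod hg.norm).const_mul ‖B‖)
    (B.aestronglyMeasurable_comp₂ hf.1.comp_fst hg.1.comp_snd) (.of_forall fun z => ?_)
  rw [← mul_assoc]
  exact B.le_opNorm₂ _ _

/-- Integration by parts in integral form, for a bilinear pairing of integrable functions. -/
theorem integral_bilin_setIntegral_add [CompleteSpace F] [CompleteSpace G] [CompleteSpace H]
    (B : F →L[ℝ] G →L[ℝ] H) {μ : Measure ℝ}
    [SFinite μ] [NullSingletonClass μ] {f : ℝ → F} {g : ℝ → G} (hf : Integrable f μ) (hg : Integrable g μ) :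
    (∫ r, B (f r) (∫ s in Set.Iic r, g s ∂μ) ∂μ) + (∫ s, B (∫ r in Set.Iic s, f r ∂μ) (g s) ∂μ)
      = B (∫ r, f r ∂μ) (∫ s, g s ∂μ) := by
  have hint := integrable_bilin_prod B hf hg
  have hT : MeasurableSet {z : ℝ × ℝ | z.2 ≤ z.1} := measurableSet_le measurable_snd measurable_fst
  -- The two terms integrate `B (f r) (g s)` over the complementary triangles `s ≤ r` and `r < s`.
  have h1 : (∫ r, B (f r) (∫ s in Set.Iic r, g s ∂μ) ∂μ)
      = ∫ z in {z : ℝ × ℝ | z.2 ≤ z.1}, B (f z.1) (g z.2) ∂(μ.prod μ) := by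
    rw [← integral_indicator hT, integral_prod _ (hint.indicator hT)]
    refine integral_congr_ae (.of_forall fun r => ?_)
    simp only
    rw [← ContinuousLinearMap.integral_comp_comm _ hg.integrableOn,
      ← integral_indicator measurableSet_Iic]
    refine integral_congr_ae (.of_forall fun s => ?_)
    simp [Set.indicator_apply]
  have h2 : (∫ s, B (∫ r in Set.Iic s, f r ∂μ) (g s) ∂μ)
      = ∫ z in {z : ℝ × ℝ | z.2 ≤ z.1}ᶜ, B (f z.1) (g z.2) ∂(μ.prod μ) := by
    rw [← integral_indicator hT.compl, integral_prod_symm _ (hint.indicator hT.compl)]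
    refine integral_congr_ae (.of_forall fun s => ?_)
    simp only
    -- The complementary triangle is strict; the diagonal is lost harmlessly because singletons are
    -- null.
    rw [setIntegral_congr_set (Iio_ae_eq_Iic (μ := μ) (a := s)).symm]
    change B.flip (g s) _ = _
    rw [← ContinuousLinearMap.integral_comp_comm _ hf.integrableOn,
      ← integral_indicator measurableSet_Iio]
    refine integral_congr_ae (.of_forall fun r => ?_)
    simp [Set.indicator_apply]
  rw [h1, h2, integral_add_compl hT hint, integral_prod _ hint]
  calc _ = ∫ r, B.flip (∫ s, g s ∂μ) (f r) ∂μ := by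
        refine integral_congr_ae (.of_forall fun r => ?_)
        exact (B (f r)).integral_comp_comm hg
    _ = _ := (B.flip (∫ s, g s ∂μ)).integral_comp_comm hf

theorem intervalIntegrable_bilin_right (B : F →L[ℝ] G →L[ℝ] H) {f : ℝ → F} {g : ℝ → G} {a b : ℝ}
    (hf : IntervalIntegrable f volume a b) (hg : Continuous g) :
    IntervalIntegrable (fun r => B (f r) (g r)) volume a b := by
  obtain ⟨C, hC⟩ := (isCompact_uIcc (a := a) (b := b)).exists_bound_of_continuousOn hg.continuousOn
  rw [intervalIntegrable_iff] at hf ⊢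
  refine B.integrable_of_bilin_of_bdd_right C hf hg.aestronglyMeasurable ?_
  refine (ae_restrict_iff' measurableSet_uIoc).2 (.of_forall fun r hr => ?_)
  exact hC r (Set.uIoc_subset_uIcc hr)

theorem intervalIntegrable_bilin_left (B : F →L[ℝ] G →L[ℝ] H) {f : ℝ → F} {g : ℝ → G} {a b : ℝ}
    (hf : Continuous f) (hg : IntervalIntegrable g volume a b) :
    IntervalIntegrable (fun r => B (f r) (g r)) volume a b :=
  intervalIntegrable_bilin_right B.flip hg hf

theorem continuous_of_sub_eq_integral {f u : ℝ → F}
    (hf : ∀ a b, IntervalIntegrable f volume a b)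
    (hu : ∀ a b, u b - u a = ∫ r in a..b, f r) : Continuous u := by
  have : u = fun t => u 0 + ∫ r in (0 : ℝ)..t, f r := by
    funext t; rw [← hu 0 t]; abel
  rw [this]
  exact continuous_const.add (intervalIntegral.continuous_primitive hf 0)

/-- The product rule for a bilinear pairing of indefinite integrals. -/
theorem bilin_sub_eq_integral [CompleteSpace F] [CompleteSpace G] [CompleteSpace H]
    (B : F →L[ℝ] G →L[ℝ] H) {f u : ℝ → F} {g v : ℝ → G}
    (hf : ∀ a b, IntervalIntegrable f volume a b) (hg : ∀ a b, IntervalIntegrable g volume a b)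
    (hu : ∀ a b, u b - u a = ∫ r in a..b, f r) (hv : ∀ a b, v b - v a = ∫ r in a..b, g r)
    (a b : ℝ) :
    B (u b) (v b) - B (u a) (v a) = ∫ r in a..b, (B (f r) (v r) + B (u r) (g r)) := by
  wlog hab : a ≤ b generalizing a b
  · rw [intervalIntegral.integral_symm, ← this b a (le_of_not_ge hab)]; abel
  have hu' := continuous_of_sub_eq_integral hf hu
  have hv' := continuous_of_sub_eq_integral hg hv
  -- Over `(a,b]` the inner integrals are the increments `v r - v a` and `u r - u a`; the constant
  -- parts yield the boundary terms.
  have key := integral_bilin_setIntegral_add B (μ := volume.restrict (Set.Ioc a b))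
    ((intervalIntegrable_iff_integrableOn_Ioc_of_le hab).1 (hf a b))
    ((intervalIntegrable_iff_integrableOn_Ioc_of_le hab).1 (hg a b))
  have hset {r : ℝ} (hr : r ∈ Set.Ioc a b) :
      (volume.restrict (Set.Ioc a b)).restrict (Set.Iic r) = volume.restrict (Set.Ioc a r) := by
    rw [Measure.restrict_restrict measurableSet_Iic]
    congr 1
    ext x
    simp only [Set.mem_inter_iff, Set.mem_Iic, Set.mem_Ioc]
    grind
  have e1 : (∫ r in Set.Ioc a b, B (f r) (∫ s in Set.Iic r, g s ∂(volume.restrict (Set.Ioc a b))))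
      = ∫ r in a..b, (B (f r) (v r) - B.flip (v a) (f r)) := by
    rw [intervalIntegral.integral_of_le hab]
    refine setIntegral_congr_fun measurableSet_Ioc fun r hr => ?_
    rw [hset hr, ← intervalIntegral.integral_of_le hr.1.le, ← hv a r]
    simp
  have e2 : (∫ s in Set.Ioc a b, B (∫ r in Set.Iic s, f r ∂(volume.restrict (Set.Ioc a b))) (g s))
      = ∫ r in a..b, (B (u r) (g r) - B (u a) (g r)) := by
    rw [intervalIntegral.integral_of_le hab]
    refine setIntegral_congr_fun measurableSet_Ioc fun r hr => ?_
    rw [hset hr, ← intervalIntegral.integral_of_le hr.1.le, ← hu a r]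
    simp
  have i1 := intervalIntegrable_bilin_right B (hf a b) hv'
  have i2 := intervalIntegrable_bilin_left B hu' (hg a b)
  have i3 : IntervalIntegrable (fun r => B.flip (v a) (f r)) volume a b :=
    intervalIntegrable_bilin_right B (hf a b) continuous_const
  have i4 : IntervalIntegrable (fun r => B (u a) (g r)) volume a b :=
    intervalIntegrable_bilin_left B continuous_const (hg a b)
  rw [e1, e2, intervalIntegral.integral_sub i1 i3, intervalIntegral.integral_sub i2 i4,
    ContinuousLinearMap.intervalIntegral_comp_comm _ (hf a b),
    ContinuousLinearMap.intervalIntegral_comp_comm _ (hg a b),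
    ← intervalIntegral.integral_of_le hab, ← intervalIntegral.integral_of_le hab,
    ← hu a b, ← hv a b] at key
  rw [intervalIntegral.integral_add i1 i2]
  simp only [map_sub, sub_apply, ContinuousLinearMap.flip_apply] at key ⊢
  rw [← sub_eq_zero] at key ⊢
  rw [← neg_eq_zero, ← key]
  abel

end ProductRule

/-! ### Linear Carathéodory equations by Picard series -/

section Picard

variable {F : Type*} [NormedAddCommGroup F] [NormedSpace ℝ F]

/-- Since `m` need not be differentiable everywhere, the chain rule is replaced by induction with
the product rule. -/
theorem pow_succ_sub_eq_integral {l m : ℝ → ℝ} (hl : ∀ a b, IntervalIntegrable l volume a b)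
    (hm : ∀ a b, m b - m a = ∫ r in a..b, l r) (n : ℕ) (a b : ℝ) :
    m b ^ (n + 1) - m a ^ (n + 1) = ∫ r in a..b, (n + 1) * (l r * m r ^ n) := by
  have hmc := continuous_of_sub_eq_integral hl hm
  induction n generalizing a b with
  | zero => simpa using hm a b
  | succ n ih =>
    have h := bilin_sub_eq_integral (ContinuousLinearMap.mul ℝ ℝ)
      (fun a b => (((hl a b).mul_continuousOn (hmc.pow n).continuousOn).const_mul ((n : ℝ) + 1)))
      hl ih hm a b
    simp only [ContinuousLinearMap.mul_apply', Pi.pow_apply] at h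
    rw [pow_succ (m b), pow_succ (m a), h]
    refine intervalIntegral.integral_congr fun r _ => ?_
    push_cast
    ring

theorem abs_integral_mul_abs_pow {l : ℝ → ℝ} (hl : ∀ a b, IntervalIntegrable l volume a b)
    (hl0 : ∀ r, 0 ≤ l r) (n : ℕ) (s t : ℝ) :
    |∫ r in s..t, l r * |∫ q in s..r, l q| ^ n| = |∫ q in s..t, l q| ^ (n + 1) / (n + 1) := by
  have hm : ∀ a b, (∫ q in s..b, l q) - (∫ q in s..a, l q) = ∫ r in a..b, l r := fun a b =>
    intervalIntegral.integral_interval_sub_left (hl s b) (hl s a)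
  have hpow := pow_succ_sub_eq_integral hl hm n s t
  rw [intervalIntegral.integral_const_mul, intervalIntegral.integral_same,
    zero_pow (Nat.succ_ne_zero n), sub_zero] at hpow
  have hn : (0 : ℝ) < n + 1 := by positivity
  -- `σ` is the orientation of the interval, so that forward and backward time are treated at once.
  obtain ⟨σ, hσ, hσm⟩ : ∃ σ : ℝ, |σ| = 1 ∧
      ∀ r ∈ Set.uIcc s t, |∫ q in s..r, l q| = σ * ∫ q in s..r, l q := by
    rcases le_total s t with h | h
    · refine ⟨1, by simp, fun r hr => ?_⟩
      rw [Set.uIcc_of_le h] at hr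
      rw [one_mul, abs_of_nonneg (intervalIntegral.integral_nonneg hr.1 fun q _ => hl0 q)]
    · refine ⟨-1, by simp, fun r hr => ?_⟩
      rw [Set.uIcc_of_ge h] at hr
      rw [intervalIntegral.integral_symm, abs_neg,
        abs_of_nonneg (intervalIntegral.integral_nonneg hr.2 fun q _ => hl0 q)]
      ring
  have : ∫ r in s..t, l r * |∫ q in s..r, l q| ^ n
      = σ ^ n * ∫ r in s..t, l r * (∫ q in s..r, l q) ^ n := by
    rw [← intervalIntegral.integral_const_mul]
    refine intervalIntegral.integral_congr fun r hr => ?_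
    rw [hσm r hr]
    ring
  rw [this, abs_mul, abs_pow, hσ, one_pow, one_mul, ← abs_pow, hpow, abs_mul, abs_of_pos hn]
  field_simp

/-- The terms of the Picard (Peano–Baker) series of `x' = A(t) x`, `x(s) = x₀`. -/
def picardTerm (A : ℝ → F →L[ℝ] F) (s : ℝ) (x₀ : F) : ℕ → ℝ → F
  | 0 => fun _ => x₀
  | n + 1 => fun t => ∫ r in s..t, A r (picardTerm A s x₀ n r)

theorem continuous_picardTerm {A : ℝ → F →L[ℝ] F}
    (hA : ∀ a b, IntervalIntegrable A volume a b) (s : ℝ) (x₀ : F) (n : ℕ) : Continuous (picardTerm A s x₀ n) := by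
  induction n with
  | zero => exact continuous_const
  | succ n ih =>
    exact intervalIntegral.continuous_primitive (fun a b =>
      intervalIntegrable_bilin_right (ContinuousLinearMap.id ℝ (F →L[ℝ] F)) (hA a b) ih) s

/-- Each integration of `‖A‖ mⁿ`, with `m` the primitive of `‖A‖`, contributes a factor `1/(n+1)`;
these build up the factorial. -/
theorem norm_picardTerm_le {A : ℝ → F →L[ℝ] F}
    (hA : ∀ a b, IntervalIntegrable A volume a b) (s : ℝ) (x₀ : F) (n : ℕ) (t : ℝ) :
    ‖picardTerm A s x₀ n t‖ ≤ ‖x₀‖ * (|∫ r in s..t, ‖A r‖| ^ n / n.factorial) := by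
  have hl : ∀ a b, IntervalIntegrable (fun r => ‖A r‖) volume a b := fun a b => (hA a b).norm
  have hm : Continuous fun t => ∫ r in s..t, ‖A r‖ := intervalIntegral.continuous_primitive hl s
  induction n generalizing t with
  | zero => simp [picardTerm]
  | succ n ih =>
    have hle : ∀ r, ‖A r (picardTerm A s x₀ n r)‖
        ≤ ‖x₀‖ / n.factorial * (‖A r‖ * |∫ q in s..r, ‖A q‖| ^ n) := fun r =>
      calc _ ≤ ‖A r‖ * ‖picardTerm A s x₀ n r‖ := (A r).le_opNorm _
        _ ≤ ‖A r‖ * (‖x₀‖ * (|∫ q in s..r, ‖A q‖| ^ n / n.factorial)) := by gcongr; exact ih r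
        _ = _ := by ring
    calc _ ≤ |∫ r in s..t, ‖x₀‖ / n.factorial * (‖A r‖ * |∫ q in s..r, ‖A q‖| ^ n)| :=
          intervalIntegral.norm_integral_le_abs_of_norm_le (.of_forall fun r => hle r)
            (((hl s t).mul_continuousOn (hm.abs.pow n).continuousOn).const_mul _)
      _ = _ := by
        rw [intervalIntegral.integral_const_mul, abs_mul,
          abs_integral_mul_abs_pow hl (fun r => norm_nonneg _), abs_of_nonneg (by positivity),
          Nat.factorial_succ]
        push_cast
        field_simp

theorem exists_linear_caratheodory_solution [CompleteSpace F] {A : ℝ → F →L[ℝ] F}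
    (hA : ∀ a b, IntervalIntegrable A volume a b) (s : ℝ) (x₀ : F) :
    ∃ x : ℝ → F, Continuous x ∧ ∀ t, x t = x₀ + ∫ r in s..t, A r (x r) := by
  have hl : ∀ a b, IntervalIntegrable (fun r => ‖A r‖) volume a b := fun a b => (hA a b).norm
  have hm : Continuous fun t => ∫ r in s..t, ‖A r‖ := intervalIntegral.continuous_primitive hl s
  have hbound := norm_picardTerm_le hA s x₀
  have hsummable : ∀ t, Summable fun n => picardTerm A s x₀ n t := fun t =>
    .of_norm_bounded ((Real.summable_pow_div_factorial _).mul_left _) (fun n => hbound n t)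
  refine ⟨fun t => ∑' n, picardTerm A s x₀ n t, ?_, fun t => ?_⟩
  -- Weierstrass test on a neighbourhood of `t` where the primitive of `‖A‖` stays below `c`; the `+
  -- 1` leaves room around `t`.
  · refine continuous_iff_continuousAt.2 fun t => ?_
    set c := |∫ r in s..t, ‖A r‖| + 1
    have hU : IsOpen {u | |∫ r in s..u, ‖A r‖| < c} := isOpen_lt hm.abs continuous_const
    refine ContinuousOn.continuousAt (s := {u | |∫ r in s..u, ‖A r‖| < c}) ?_
      (hU.mem_nhds (by simp [c]))
    refine continuousOn_tsum (fun n => (continuous_picardTerm hA s x₀ n).continuousOn)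
      ((Real.summable_pow_div_factorial c).mul_left ‖x₀‖) fun n u hu => (hbound n u).trans ?_
    have : |∫ r in s..u, ‖A r‖| ≤ c := le_of_lt hu
    gcongr
  -- Termwise integration, dominated by `‖A r‖` times an exponential series.
  · have hdom : HasSum (fun n => ∫ r in s..t, A r (picardTerm A s x₀ n r))
        (∫ r in s..t, A r (∑' n, picardTerm A s x₀ n r)) := by
      have hsum : ∀ r, HasSum
          (fun n => ‖A r‖ * (‖x₀‖ * (|∫ q in s..r, ‖A q‖| ^ n / n.factorial)))
          (‖A r‖ * (‖x₀‖ * Real.exp |∫ q in s..r, ‖A q‖|)) := fun r => by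
        have hexp : ∀ y : ℝ, HasSum (fun n : ℕ => y ^ n / n.factorial) (Real.exp y) := fun y => by
          rw [Real.exp_eq_exp_ℝ]
          exact NormedSpace.expSeries_div_hasSum_exp y
        exact ((hexp _).mul_left _).mul_left _
      have hint : IntervalIntegrable (fun r => ∑' n : ℕ,
          ‖A r‖ * (‖x₀‖ * (|∫ q in s..r, ‖A q‖| ^ n / n.factorial))) volume s t := by
        simp_rw [fun r => (hsum r).tsum_eq]
        exact (hl s t).mul_continuousOn
          (continuous_const.mul (Real.continuous_exp.comp hm.abs)).continuousOn
      have hmeas (n : ℕ) : AEStronglyMeasurable (fun r => A r (picardTerm A s x₀ n r))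
          (volume.restrict (Set.uIoc s t)) :=
        (intervalIntegrable_iff.1 (intervalIntegrable_bilin_right
          (ContinuousLinearMap.id ℝ (F →L[ℝ] F)) (hA s t) (continuous_picardTerm hA s x₀ n))).1
      have hle (n : ℕ) (r : ℝ) : ‖A r (picardTerm A s x₀ n r)‖ ≤
          ‖A r‖ * (‖x₀‖ * (|∫ q in s..r, ‖A q‖| ^ n / n.factorial)) :=
        ((A r).le_opNorm _).trans (mul_le_mul_of_nonneg_left (hbound n r) (norm_nonneg _))
      exact intervalIntegral.hasSum_integral_of_dominated_convergence _ hmeas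
        (fun n => Eventually.of_forall fun r _ => hle n r)
        (Eventually.of_forall fun r _ => (hsum r).summable) hint
        (Eventually.of_forall fun r _ => (A r).hasSum (hsummable r).hasSum)
    beta_reduce
    rw [(hsummable t).tsum_eq_zero_add, ← hdom.tsum_eq]
    rfl

end Picard

/-! ### Operator equations and their adjoints -/

section OperatorSolutions

variable {V : Type*} [NormedAddCommGroup V] [NormedSpace ℝ V] [CompleteSpace V]
  {L : ℝ → V →L[ℝ] V}

theorem exists_left_operator_solution (hL : ∀ a b, IntervalIntegrable L volume a b) :
    ∃ X : ℝ → V →L[ℝ] V, Continuous X ∧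
      ∀ t, X t = ContinuousLinearMap.id ℝ V + ∫ r in (0 : ℝ)..t, (L r).comp (X r) :=
  exists_linear_caratheodory_solution (A := fun r => ContinuousLinearMap.compL ℝ V V V (L r))
    (fun a b => intervalIntegrable_iff.2 ((ContinuousLinearMap.compL ℝ V V V).integrable_comp
      (intervalIntegrable_iff.1 (hL a b)))) 0 (ContinuousLinearMap.id ℝ V)

theorem exists_right_operator_solution (hL : ∀ a b, IntervalIntegrable L volume a b) :
    ∃ Y : ℝ → V →L[ℝ] V, Continuous Y ∧
      ∀ t, Y t = ContinuousLinearMap.id ℝ V + ∫ r in (0 : ℝ)..t, -(Y r).comp (L r) :=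
  exists_linear_caratheodory_solution
    (A := fun r => (-(ContinuousLinearMap.compL ℝ V V V).flip) (L r))
    (fun a b => intervalIntegrable_iff.2 ((-(ContinuousLinearMap.compL ℝ V V V).flip).integrable_comp
      (intervalIntegrable_iff.1 (hL a b)))) 0 (ContinuousLinearMap.id ℝ V)

end OperatorSolutions

/-! ### Fundamental matrices and variation of constants -/

section FundamentalPair

variable {d : ℕ} {L : ℝ → Op d} {X Y : ℝ → Op d}

theorem sub_eq_integral_of_eq_add_integral {F : Type*} [NormedAddCommGroup F] [NormedSpace ℝ F]
    {f x : ℝ → F} {s : ℝ} {x₀ : F} (hf : ∀ a b, IntervalIntegrable f volume a b)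
    (hx : ∀ t, x t = x₀ + ∫ r in s..t, f r) (a b : ℝ) : x b - x a = ∫ r in a..b, f r := by
  rw [hx a, hx b, add_sub_add_left_eq_sub,
    intervalIntegral.integral_interval_sub_left (hf s b) (hf s a)]

/-- Composition of operators as a bilinear map. -/
abbrev compBilin (d : ℕ) : Op d →L[ℝ] Op d →L[ℝ] Op d :=
  ContinuousLinearMap.compL ℝ (E d) (E d) (E d)

/-- Application of operators to vectors as a bilinear map. -/
abbrev applyBilin (d : ℕ) : Op d →L[ℝ] E d →L[ℝ] E d := ContinuousLinearMap.id ℝ (Op d)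

/-- `X` is a fundamental matrix of `x' = L(t) x` and `Y` is its pointwise inverse, which solves
the adjoint equation. -/
structure IsFundamentalPair (L : ℝ → Op d) (X Y : ℝ → Op d) : Prop where
  intervalIntegrable : ∀ a b, IntervalIntegrable L volume a b
  continuous_left : Continuous X
  continuous_right : Continuous Y
  left_sub : ∀ a b, X b - X a = ∫ r in a..b, (L r).comp (X r)
  right_sub : ∀ a b, Y b - Y a = ∫ r in a..b, -(Y r).comp (L r)
  right_comp_left : ∀ t, (Y t).comp (X t) = ContinuousLinearMap.id ℝ (E d)
  left_comp_right : ∀ t, (X t).comp (Y t) = ContinuousLinearMap.id ℝ (E d)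

theorem exists_isFundamentalPair (hL : LocallyIntegrable L volume) :
    ∃ X Y : ℝ → Op d, IsFundamentalPair L X Y := by
  have hLi : ∀ a b, IntervalIntegrable L volume a b := fun a b =>
    (hL.integrableOn_isCompact isCompact_uIcc).intervalIntegrable
  obtain ⟨X, hXc, hX⟩ := exists_left_operator_solution hLi
  obtain ⟨Y, hYc, hY⟩ := exists_right_operator_solution hLi
  have iX (a b : ℝ) : IntervalIntegrable (fun r => (L r).comp (X r)) volume a b :=
    intervalIntegrable_bilin_right (compBilin d) (hLi a b) hXc
  have iY (a b : ℝ) : IntervalIntegrable (fun r => -(Y r).comp (L r)) volume a b :=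
    (intervalIntegrable_bilin_left (compBilin d) hYc (hLi a b)).neg
  have sX := sub_eq_integral_of_eq_add_integral iX hX
  have sY := sub_eq_integral_of_eq_add_integral iY hY
  -- `(YX)' = -YLX + YLX = 0`, so `YX` keeps its value `Id` at `0`.
  have hYX (t : ℝ) : (Y t).comp (X t) = ContinuousLinearMap.id ℝ (E d) := by
    have h : (Y t).comp (X t) - (Y 0).comp (X 0) = ∫ r in (0 : ℝ)..t,
        ((-(Y r).comp (L r)).comp (X r) + (Y r).comp ((L r).comp (X r))) :=
      bilin_sub_eq_integral (compBilin d) iY iX sY sX 0 t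
    have h0 : ∀ r, (-(Y r).comp (L r)).comp (X r) + (Y r).comp ((L r).comp (X r))
        = 0 := fun r => by ext v : 1; simp
    simp only [h0, intervalIntegral.integral_zero, sub_eq_zero] at h
    have hX0 : X 0 = ContinuousLinearMap.id ℝ (E d) := by simpa using hX 0
    have hY0 : Y 0 = ContinuousLinearMap.id ℝ (E d) := by simpa using hY 0
    simpa [hX0, hY0] using h
  refine ⟨X, Y, hLi, hXc, hYc, sX, sY, hYX, fun t => ?_⟩
  -- In finite dimension a left inverse is also a right inverse.
  have h := congrArg (fun T : Op d => (T : E d →ₗ[ℝ] E d)) (hYX t)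
  exact ContinuousLinearMap.coe_injective (mul_eq_one_comm.1 h)

namespace IsFundamentalPair

theorem right_apply_left (h : IsFundamentalPair L X Y) (t : ℝ) (v : E d) : Y t (X t v) = v :=
  congrArg (fun T : Op d => T v) (h.right_comp_left t)

theorem left_apply_right (h : IsFundamentalPair L X Y) (t : ℝ) (v : E d) : X t (Y t v) = v :=
  congrArg (fun T : Op d => T v) (h.left_comp_right t)

theorem intervalIntegrable_right (h : IsFundamentalPair L X Y) (a b : ℝ) :
    IntervalIntegrable (fun r => -(Y r).comp (L r)) volume a b :=
  (intervalIntegrable_bilin_left (compBilin d) h.continuous_right (h.intervalIntegrable a b)).neg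

theorem intervalIntegrable_left (h : IsFundamentalPair L X Y) (a b : ℝ) :
    IntervalIntegrable (fun r => (L r).comp (X r)) volume a b :=
  intervalIntegrable_bilin_right (compBilin d) (h.intervalIntegrable a b) h.continuous_left

theorem isPrincipalSolutionAt (h : IsFundamentalPair L X Y) (s : ℝ) :
    IsPrincipalSolutionAt L s (fun t => (X t).comp (Y s)) := by
  refine ⟨h.continuous_left.clm_comp continuous_const, fun t => ?_⟩
  have e : ∫ r in s..t, (L r).comp ((X r).comp (Y s)) = (X t - X s).comp (Y s) := by
    rw [h.left_sub s t]
    exact ((compBilin d).flip (Y s)).intervalIntegral_comp_comm (h.intervalIntegrable_left s t)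
  rw [e, ContinuousLinearMap.sub_comp, h.left_comp_right]
  abel

/-- Uniqueness without Gronwall: `YZ` is constant by the product rule, and `X` inverts `Y`. -/
theorem eq_of_isPrincipalSolutionAt (h : IsFundamentalPair L X Y) {s : ℝ} {Z : ℝ → Op d}
    (hZ : IsPrincipalSolutionAt L s Z) (t : ℝ) : Z t = (X t).comp (Y s) := by
  have iZ (a b : ℝ) : IntervalIntegrable (fun r => (L r).comp (Z r)) volume a b :=
    intervalIntegrable_bilin_right (compBilin d) (h.intervalIntegrable a b) hZ.1
  have sZ := sub_eq_integral_of_eq_add_integral iZ hZ.2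
  have hp : (Y t).comp (Z t) - (Y s).comp (Z s) = ∫ r in s..t,
      ((-(Y r).comp (L r)).comp (Z r) + (Y r).comp ((L r).comp (Z r))) :=
    bilin_sub_eq_integral (compBilin d) h.intervalIntegrable_right iZ h.right_sub sZ s t
  have h0 : ∀ r, (-(Y r).comp (L r)).comp (Z r) + (Y r).comp ((L r).comp (Z r))
      = 0 := fun r => by ext v : 1; simp
  have hYZ : (Y t).comp (Z t) = (Y s).comp (Z s) := by
    simpa only [h0, intervalIntegral.integral_zero, sub_eq_zero] using hp
  have hZs : Z s = ContinuousLinearMap.id ℝ (E d) := by simpa using hZ.2 s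
  ext v : 1
  have hv : Y t (Z t v) = Y s v := by
    simpa [hZs] using congrArg (fun T : Op d => T v) hYZ
  rw [ContinuousLinearMap.comp_apply, ← hv, h.left_apply_right]

/-- `principalSolution` is a choice; existence and uniqueness identify it as `X(t)Y(s)`. -/
theorem principalSolution_eq (h : IsFundamentalPair L X Y) (t s : ℝ) :
    principalSolution L t s = (X t).comp (Y s) :=
  h.eq_of_isPrincipalSolutionAt
    (Classical.epsilon_spec (p := IsPrincipalSolutionAt L s) ⟨_, h.isPrincipalSolutionAt s⟩) t

/-- Variation of constants. -/
theorem isSolution_iff (h : IsFundamentalPair L X Y) {ρ : ℝ} {ξ : ℝ → E d}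
    (hξ : ∀ a b, IntervalIntegrable ξ volume a b) {t₀ : ℝ} {x₀ : E d} {x : ℝ → E d} :
    IsSolution L ρ ξ t₀ x₀ x ↔
      ∀ t, x t = X t (Y t₀ x₀ + ρ • ∫ s in t₀..t, Y s (ξ s)) := by
  have iρ (a b : ℝ) : IntervalIntegrable (fun r => ρ • ξ r) volume a b := (hξ a b).smul ρ
  constructor
  · rintro ⟨hxc, hx⟩ t
    have ix (a b : ℝ) : IntervalIntegrable (fun r => L r (x r) + ρ • ξ r) volume a b :=
      (intervalIntegrable_bilin_right (applyBilin d) (h.intervalIntegrable a b) hxc).add (iρ a b)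
    have sx := sub_eq_integral_of_eq_add_integral ix hx
    have hp := bilin_sub_eq_integral (applyBilin d) h.intervalIntegrable_right ix h.right_sub sx t₀ t
    -- In `(Yx)'` the terms with `L` cancel, leaving `ρYξ`.
    have h0 : ∀ r, applyBilin d (-(Y r).comp (L r)) (x r) + applyBilin d (Y r)
        (L r (x r) + ρ • ξ r) = ρ • Y r (ξ r) := fun r => by simp
    have hx₀ : x t₀ = x₀ := by simpa using hx t₀
    simp only [h0, intervalIntegral.integral_smul, hx₀] at hp
    have hv : Y t (x t) = Y t₀ x₀ + ρ • ∫ s in t₀..t, Y s (ξ s) := by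
      rw [← hp]; simp
    rw [← hv, h.left_apply_right]
  · intro hx
    have iY (a b : ℝ) : IntervalIntegrable (fun r => ρ • Y r (ξ r)) volume a b :=
      (intervalIntegrable_bilin_left (applyBilin d) h.continuous_right (hξ a b)).smul ρ
    set v : ℝ → E d := fun t => Y t₀ x₀ + ∫ s in t₀..t, ρ • Y s (ξ s) with hv
    have sv := sub_eq_integral_of_eq_add_integral (x := v) iY (fun t => rfl)
    have hxv : ∀ t, x t = X t (v t) := fun t => by
      rw [hx t, hv]; simp only [intervalIntegral.integral_smul]
    have hvc : Continuous v := continuous_of_sub_eq_integral iY sv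
    refine ⟨?_, fun t => ?_⟩
    · rw [funext hxv]
      exact h.continuous_left.clm_apply hvc
    · have hp := bilin_sub_eq_integral (applyBilin d) h.intervalIntegrable_left iY h.left_sub sv t₀ t
      have h0 : ∀ r, applyBilin d ((L r).comp (X r)) (v r) + applyBilin d (X r) (ρ • Y r (ξ r))
          = L r (x r) + ρ • ξ r := fun r => by
        simp [hxv r, h.left_apply_right]
      simp only [h0] at hp
      rw [← hp]
      simp [hxv t, hv, h.left_apply_right]

end IsFundamentalPair

theorem mem_controls_iff {ξ : ℝ → E d} :
    ξ ∈ controls d ↔ AEStronglyMeasurable ξ volume ∧ ∀ᵐ s, ‖ξ s‖ ≤ 1 := by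
  constructor
  · rintro ⟨h1, h2⟩
    refine ⟨h1.1, ?_⟩
    rw [eLpNorm_exponent_top] at h2
    filter_upwards [ae_le_eLpNormEssSup (f := ξ) (μ := volume)] with s hs
    have := hs.trans h2
    rwa [← ofReal_norm, ENNReal.ofReal_le_one] at this
  · rintro ⟨h1, h2⟩
    refine ⟨memLp_top_of_bound h1 1 h2, ?_⟩
    rw [eLpNorm_exponent_top]
    simpa using eLpNormEssSup_le_of_ae_bound h2

theorem intervalIntegrable_of_mem_controls {ξ : ℝ → E d} (hξ : ξ ∈ controls d) (a b : ℝ) :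
    IntervalIntegrable ξ volume a b :=
  ((hξ.1.locallyIntegrable le_top).integrableOn_isCompact isCompact_uIcc).intervalIntegrable

theorem continuous_principalSolution_right (hL : LocallyIntegrable L volume) (t : ℝ) :
    Continuous fun s => principalSolution L t s := by
  obtain ⟨X, Y, h⟩ := exists_isFundamentalPair hL
  simp only [h.principalSolution_eq]
  exact continuous_const.clm_comp h.continuous_right

theorem principalSolution_cocycle (hL : LocallyIntegrable L volume) (t s r : ℝ) (v : E d) :
    principalSolution L t s (principalSolution L s r v) = principalSolution L t r v := by
  obtain ⟨X, Y, h⟩ := exists_isFundamentalPair hL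
  simp [h.principalSolution_eq, h.right_apply_left]

/-- This formula replaces the differential equation in everything that follows. -/
theorem mem_evolution_iff (hL : LocallyIntegrable L volume) {ρ t t₀ : ℝ} {M : Set (E d)}
    {y : E d} : y ∈ evolution L ρ t t₀ M ↔ ∃ x₀ ∈ M, ∃ ξ ∈ controls d,
      y = principalSolution L t t₀ x₀ + ρ • ∫ s in t₀..t, principalSolution L t s (ξ s) := by
  obtain ⟨X, Y, h⟩ := exists_isFundamentalPair hL
  have key {x₀ : E d} {ξ : ℝ → E d} (hξ : ξ ∈ controls d) :
      principalSolution L t t₀ x₀ + ρ • ∫ s in t₀..t, principalSolution L t s (ξ s)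
        = X t (Y t₀ x₀ + ρ • ∫ s in t₀..t, Y s (ξ s)) := by
    simp only [h.principalSolution_eq, map_add, map_smul, ContinuousLinearMap.comp_apply]
    congr 2
    exact (X t).intervalIntegral_comp_comm (intervalIntegrable_bilin_left (applyBilin d)
      h.continuous_right (intervalIntegrable_of_mem_controls hξ t₀ t))
  constructor
  · rintro ⟨x₀, hx₀, ξ, hξ, x, hx, rfl⟩
    exact ⟨x₀, hx₀, ξ, hξ, by
      rw [key hξ, (h.isSolution_iff (intervalIntegrable_of_mem_controls hξ)).1 hx t]⟩
  · rintro ⟨x₀, hx₀, ξ, hξ, rfl⟩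
    exact ⟨x₀, hx₀, ξ, hξ, _,
      (h.isSolution_iff (intervalIntegrable_of_mem_controls hξ)).2 fun t => rfl, (key hξ).symm⟩

end FundamentalPair

/-! ### Compactness of sets of integrals -/

section Compactness

/-- A closed convex bounded subset of a Hilbert space has closed image under every continuous
linear map: the points of minimal norm of the approximate fibres form a Cauchy sequence. -/
theorem isClosed_image_of_convex {H F : Type*} [NormedAddCommGroup H] [InnerProductSpace ℝ H]
    [CompleteSpace H] [NormedAddCommGroup F] [NormedSpace ℝ F] (T : H →L[ℝ] F) {C : Set H}
    (hconv : Convex ℝ C) (hclosed : IsClosed C) (hbdd : Bornology.IsBounded C) :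
    IsClosed (T '' C) := by
  refine isClosed_of_closure_subset fun y hy => ?_
  let D : ℕ → Set H := fun n => C ∩ T ⁻¹' Metric.closedBall y (1 / (n + 1))
  have hDclosed (n : ℕ) : IsClosed (D n) :=
    hclosed.inter (Metric.isClosed_closedBall.preimage T.continuous)
  have hDconv (n : ℕ) : Convex ℝ (D n) :=
    hconv.inter ((convex_closedBall y _).linear_preimage (T : H →ₗ[ℝ] F))
  have hDne (n : ℕ) : (D n).Nonempty := by
    obtain ⟨_, ⟨x, hx, rfl⟩, hxy⟩ := Metric.mem_closure_iff.1 hy (1 / (n + 1)) (by positivity)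
    exact ⟨x, hx, by simpa [dist_comm] using hxy.le⟩
  have hDanti : Antitone D := fun m n hmn =>
    Set.inter_subset_inter_right _ (Set.preimage_mono (Metric.closedBall_subset_closedBall
      (by gcongr)))
  have hmin (n : ℕ) : ∃ p ∈ D n, ∀ q ∈ D n, ‖p‖ ≤ ‖q‖ := by
    obtain ⟨p, hp, hpe⟩ := exists_norm_eq_iInf_of_complete_convex (hDne n)
      (hDclosed n).isComplete (hDconv n) 0
    refine ⟨p, hp, fun q hq => ?_⟩
    have : ‖(0 : H) - p‖ ≤ ‖(0 : H) - q‖ := by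
      rw [hpe]
      exact ciInf_le (f := fun w : D n => ‖(0 : H) - w‖)
        ⟨0, by rintro _ ⟨w, rfl⟩; positivity⟩ ⟨q, hq⟩
    simpa using this
  choose p hpD hpmin using hmin
  obtain ⟨R, hR⟩ := hbdd.exists_norm_le
  have hmono : Monotone fun n => ‖p n‖ ^ 2 := fun m n hmn => by
    have := hpmin m (p n) (hDanti hmn (hpD n))
    simp only
    gcongr
  have hlim := tendsto_atTop_ciSup hmono ⟨R ^ 2, by
    rintro _ ⟨n, rfl⟩
    have := hR (p n) (hpD n).1
    simp only
    gcongr⟩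
  -- The midpoint lies in the convex set `D m`, so its norm is at least `‖p m‖`; the parallelogram
  -- law does the rest.
  have hpar {m n : ℕ} (hmn : m ≤ n) : ‖p n - p m‖ ^ 2 ≤ 2 * (‖p n‖ ^ 2 - ‖p m‖ ^ 2) := by
    have hmid : (1 / 2 : ℝ) • p n + (1 / 2 : ℝ) • p m ∈ D m :=
      hDconv m (hDanti hmn (hpD n)) (hpD m) (by norm_num) (by norm_num) (by norm_num)
    have h1 := hpmin m _ hmid
    rw [← smul_add, norm_smul] at h1
    have h2 : 2 * ‖p m‖ ≤ ‖p n + p m‖ := by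
      norm_num at h1
      linarith
    have h3 := parallelogram_law_with_norm ℝ (p n) (p m)
    nlinarith [norm_nonneg (p m)]
  have hcauchy : CauchySeq p := by
    rw [Metric.cauchySeq_iff']
    intro ε hε
    obtain ⟨N, hN⟩ := Metric.cauchySeq_iff'.1 hlim.cauchySeq (ε ^ 2 / 2) (by positivity)
    refine ⟨N, fun n hn => ?_⟩
    have h1 := hN n hn
    rw [Real.dist_eq] at h1
    have h2 := (le_abs_self _).trans_lt h1
    rw [dist_eq_norm]
    refine lt_of_pow_lt_pow_left₀ 2 hε.le ?_
    linarith [hpar hn]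
  obtain ⟨q, hq⟩ := cauchySeq_tendsto_of_complete hcauchy
  refine ⟨q, hclosed.mem_of_tendsto hq (.of_forall fun n => (hpD n).1), ?_⟩
  refine tendsto_nhds_unique ((T.continuous.tendsto q).comp hq) ?_
  refine tendsto_iff_dist_tendsto_zero.2 (squeeze_zero (fun _ => dist_nonneg)
    (fun n => (hpD n).2) tendsto_one_div_add_atTop_nhds_zero_nat)

variable {α V : Type*} [MeasurableSpace α] {μ : Measure α} [NormedAddCommGroup V]

/-- An `L²`-convergent sequence has an a.e. convergent subsequence, which preserves the pointwise
bound. -/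
theorem isClosed_setOf_ae_norm_le (w : α → ℝ) :
    IsClosed {η : Lp V 2 μ | ∀ᵐ s ∂μ, ‖η s‖ ≤ w s} := by
  refine IsSeqClosed.isClosed fun u η hu hη => ?_
  obtain ⟨φ, -, hφ⟩ := (tendstoInMeasure_of_tendsto_Lp hη).exists_seq_tendsto_ae
  have hall : ∀ᵐ s ∂μ, ∀ n, ‖u n s‖ ≤ w s := ae_all_iff.2 hu
  filter_upwards [hφ, hall] with s hs hle
  exact le_of_tendsto hs.norm (.of_forall fun n => hle _)

theorem convex_setOf_ae_norm_le [NormedSpace ℝ V] (w : α → ℝ) :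
    Convex ℝ {η : Lp V 2 μ | ∀ᵐ s ∂μ, ‖η s‖ ≤ w s} := by
  intro η hη ζ hζ a b ha hb hab
  filter_upwards [hη, hζ, Lp.coeFn_add (a • η) (b • ζ), Lp.coeFn_smul a η, Lp.coeFn_smul b ζ]
    with s h1 h2 h3 h4 h5
  rw [h3, Pi.add_apply, h4, h5, Pi.smul_apply, Pi.smul_apply]
  calc _ ≤ ‖a • η s‖ + ‖b • ζ s‖ := norm_add_le _ _
    _ = a * ‖η s‖ + b * ‖ζ s‖ := by
      rw [norm_smul, norm_smul, Real.norm_of_nonneg ha, Real.norm_of_nonneg hb]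
    _ ≤ a * w s + b * w s := by gcongr
    _ = w s := by rw [← add_mul, hab, one_mul]

theorem isBounded_setOf_ae_norm_le {w : α → ℝ} (hw : MemLp w 2 μ) :
    Bornology.IsBounded {η : Lp V 2 μ | ∀ᵐ s ∂μ, ‖η s‖ ≤ w s} := by
  refine isBounded_iff_forall_norm_le.2 ⟨‖hw.toLp w‖, fun η hη => ?_⟩
  refine Lp.norm_le_norm_of_ae_le ?_
  filter_upwards [hη, hw.coeFn_toLp] with s h1 h2
  rw [h2]
  exact h1.trans (le_abs_self _)

/-- The values `∫ κ η` over all measurable `η` with `‖η‖ ≤ w` form a compact set, if the kernel `κ`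
and the bound `w` are square integrable. -/
theorem isCompact_setOf_integral {F : Type*} [NormedAddCommGroup F] [NormedSpace ℝ F]
    [InnerProductSpace ℝ V] [CompleteSpace V] [FiniteDimensional ℝ F]
    {κ : α → V →L[ℝ] F} {w : α → ℝ} (hκ : MemLp κ 2 μ) (hw : MemLp w 2 μ) :
    IsCompact {x : F | ∃ η : α → V, AEStronglyMeasurable η μ ∧ (∀ᵐ s ∂μ, ‖η s‖ ≤ w s) ∧
      x = ∫ s, κ s (η s) ∂μ} := by
  have : CompleteSpace F := FiniteDimensional.complete ℝ F
  have : ProperSpace F := FiniteDimensional.proper ℝ F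
  let T : Lp V 2 μ →L[ℝ] F :=
    (ContinuousLinearMap.id ℝ (V →L[ℝ] F)).lpPairing μ 2 2 (hκ.toLp κ)
  have hT {η : Lp V 2 μ} {ζ : α → V} (h : η =ᵐ[μ] ζ) : T η = ∫ s, κ s (ζ s) ∂μ := by
    simp only [T, ContinuousLinearMap.lpPairing_eq_integral]
    refine integral_congr_ae ?_
    filter_upwards [h, hκ.coeFn_toLp] with s h1 h2
    rw [h1, h2]
    rfl
  have heq : {x : F | ∃ η : α → V, AEStronglyMeasurable η μ ∧ (∀ᵐ s ∂μ, ‖η s‖ ≤ w s) ∧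
      x = ∫ s, κ s (η s) ∂μ} = T '' {η : Lp V 2 μ | ∀ᵐ s ∂μ, ‖η s‖ ≤ w s} := by
    ext x
    constructor
    · rintro ⟨η, hm, hle, rfl⟩
      have hη : MemLp η 2 μ := hw.of_le hm (hle.mono fun s hs => hs.trans (le_abs_self _))
      refine ⟨hη.toLp η, ?_, hT hη.coeFn_toLp⟩
      filter_upwards [hη.coeFn_toLp, hle] with s h1 h2
      rwa [h1]
    · rintro ⟨η, hle, rfl⟩
      exact ⟨η, Lp.aestronglyMeasurable η, hle, hT EventuallyEq.rfl⟩
  rw [heq]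
  exact Metric.isCompact_of_isClosed_isBounded
    (isClosed_image_of_convex T (convex_setOf_ae_norm_le w) (isClosed_setOf_ae_norm_le w)
      (isBounded_setOf_ae_norm_le hw))
    (T.lipschitz.isBounded_image (isBounded_setOf_ae_norm_le hw))

end Compactness

/-! ### The attractor under exponential stability -/

section Stable

variable {d : ℕ} {L : ℝ → Op d} {K γ ρ : ℝ}

theorem exp_neg_mul_sub (γ t s : ℝ) :
    Real.exp (-γ * (t - s)) = Real.exp (-γ * t) * Real.exp (γ * s) := by
  rw [← Real.exp_add]; ring_nf

theorem integrableOn_exp_decay (hγ : 0 < γ) (t : ℝ) :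
    IntegrableOn (fun s => Real.exp (-γ * (t - s))) (Set.Iic t) := by
  simp_rw [exp_neg_mul_sub γ t]
  exact (integrableOn_exp_mul_Iic hγ t).const_mul _

theorem integral_exp_decay (hγ : 0 < γ) (t : ℝ) :
    ∫ s in Set.Iic t, Real.exp (-γ * (t - s)) = 1 / γ := by
  simp_rw [exp_neg_mul_sub γ t]
  rw [integral_const_mul, integral_exp_mul_Iic hγ, ← mul_div_assoc, ← Real.exp_add]
  simp

theorem ae_norm_principalSolution_apply_le
    (hK : ∀ s t : ℝ, s ≤ t → ‖principalSolution L t s‖ ≤ K * Real.exp (-γ * (t - s)))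
    {ξ : ℝ → E d} (hξ : ξ ∈ controls d) (t : ℝ) :
    ∀ᵐ s ∂(volume.restrict (Set.Iic t)),
      ‖principalSolution L t s (ξ s)‖ ≤ K * Real.exp (-γ * (t - s)) := by
  filter_upwards [ae_restrict_of_ae (mem_controls_iff.1 hξ).2, ae_restrict_mem measurableSet_Iic]
    with s h1 h2
  calc _ ≤ ‖principalSolution L t s‖ * ‖ξ s‖ := ContinuousLinearMap.le_opNorm _ _
    _ ≤ ‖principalSolution L t s‖ * 1 := by gcongr
    _ ≤ _ := by rw [mul_one]; exact hK s t h2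

theorem integrableOn_principalSolution_apply (hL : LocallyIntegrable L volume) (hγ : 0 < γ)
    (hK : ∀ s t : ℝ, s ≤ t → ‖principalSolution L t s‖ ≤ K * Real.exp (-γ * (t - s)))
    {ξ : ℝ → E d} (hξ : ξ ∈ controls d) (t : ℝ) :
    IntegrableOn (fun s => principalSolution L t s (ξ s)) (Set.Iic t) :=
  Integrable.mono' ((integrableOn_exp_decay hγ t).const_mul K)
    ((applyBilin d).aestronglyMeasurable_comp₂
      (continuous_principalSolution_right hL t).aestronglyMeasurable
      (mem_controls_iff.1 hξ).1.restrict)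
    (ae_norm_principalSolution_apply_le hK hξ t)

theorem norm_le_of_mem_attractor (hρ : 0 < ρ) (hγ : 0 < γ)
    (hK : ∀ s t : ℝ, s ≤ t → ‖principalSolution L t s‖ ≤ K * Real.exp (-γ * (t - s)))
    {t : ℝ} {x : E d} (hx : x ∈ attractor L ρ t) : ‖x‖ ≤ ρ * (K * (1 / γ)) := by
  obtain ⟨ξ, hξ, rfl⟩ := hx
  rw [norm_smul, Real.norm_of_nonneg hρ.le]
  gcongr
  rw [← integral_exp_decay hγ t, ← integral_const_mul]
  exact norm_integral_le_of_norm_le ((integrableOn_exp_decay hγ t).const_mul K)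
    (ae_norm_principalSolution_apply_le hK hξ t)

theorem uniformlyBounded_attractor (hρ : 0 < ρ) (hγ : 0 < γ)
    (hK : ∀ s t : ℝ, s ≤ t → ‖principalSolution L t s‖ ≤ K * Real.exp (-γ * (t - s))) :
    UniformlyBounded (attractor L ρ) := by
  -- The sign of `K` is not assumed here, and the ball is open; hence `max 0` and `+ 1`.
  refine ⟨max 0 (ρ * (K * (1 / γ))) + 1, by positivity, fun t x hx => ?_⟩
  rw [mem_ball_zero_iff]
  exact ((norm_le_of_mem_attractor hρ hγ hK hx).trans (le_max_right _ _)).trans_lt (lt_add_one _)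

theorem zero_mem_controls : (0 : ℝ → E d) ∈ controls d :=
  mem_controls_iff.2 ⟨aestronglyMeasurable_zero, by simp⟩

theorem attractor_nonempty (t : ℝ) : (attractor L ρ t).Nonempty := ⟨_, 0, zero_mem_controls, rfl⟩

theorem piecewise_mem_controls {A : Set ℝ} [DecidablePred (· ∈ A)] (hA : MeasurableSet A)
    {ξ ζ : ℝ → E d} (hξ : ξ ∈ controls d) (hζ : ζ ∈ controls d) :
    A.piecewise ξ ζ ∈ controls d := by
  rw [mem_controls_iff] at hξ hζ ⊢
  refine ⟨hξ.1.restrict.piecewise hA hζ.1.restrict, ?_⟩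
  filter_upwards [hξ.2, hζ.2] with s h1 h2
  by_cases hs : s ∈ A <;> simp [hs, h1, h2]

/-- For `s ≤ t₀` the cocycle property factors `Ψ(t,s)` through time `t₀`. -/
theorem setIntegral_Iic_principalSolution_split (hL : LocallyIntegrable L volume) (hγ : 0 < γ)
    (hK : ∀ s t : ℝ, s ≤ t → ‖principalSolution L t s‖ ≤ K * Real.exp (-γ * (t - s)))
    {ξ : ℝ → E d} (hξ : ξ ∈ controls d) {t₀ t : ℝ} (ht : t₀ ≤ t) :
    ∫ s in Set.Iic t, principalSolution L t s (ξ s)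
      = principalSolution L t t₀ (∫ s in Set.Iic t₀, principalSolution L t₀ s (ξ s))
        + ∫ s in t₀..t, principalSolution L t s (ξ s) := by
  have hi := integrableOn_principalSolution_apply hL hγ hK hξ t
  rw [← intervalIntegral.integral_Iic_sub_Iic (hi.mono_set (Set.Iic_subset_Iic.2 ht)) hi,
    ← ContinuousLinearMap.integral_comp_comm _
      (integrableOn_principalSolution_apply hL hγ hK hξ t₀)]
  simp_rw [principalSolution_cocycle hL]
  abel

theorem evolution_attractor (hL : LocallyIntegrable L volume) (hγ : 0 < γ)
    (hK : ∀ s t : ℝ, s ≤ t → ‖principalSolution L t s‖ ≤ K * Real.exp (-γ * (t - s)))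
    {t₀ t : ℝ} (ht : t₀ ≤ t) : evolution L ρ t t₀ (attractor L ρ t₀) = attractor L ρ t := by
  classical
  ext y
  rw [mem_evolution_iff hL]
  constructor
  · rintro ⟨_, ⟨ξ, hξ, rfl⟩, ζ, hζ, rfl⟩
    -- Follow the past control `ξ` up to `t₀` and `ζ` afterwards.
    have hc := piecewise_mem_controls (measurableSet_Iic (a := t₀)) hξ hζ
    refine ⟨_, hc, ?_⟩
    rw [setIntegral_Iic_principalSolution_split hL hγ hK hc ht, map_smul, ← smul_add]
    congr 2
    · congr 1
      refine setIntegral_congr_fun measurableSet_Iic fun s hs => ?_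
      rw [Set.piecewise_eq_of_mem _ _ _ hs]
    · rw [intervalIntegral.integral_of_le ht, intervalIntegral.integral_of_le ht]
      refine setIntegral_congr_fun measurableSet_Ioc fun s hs => ?_
      rw [Set.piecewise_eq_of_notMem _ _ _ (Set.notMem_Iic.2 hs.1)]
  · rintro ⟨ξ, hξ, rfl⟩
    refine ⟨_, ⟨ξ, hξ, rfl⟩, ξ, hξ, ?_⟩
    rw [setIntegral_Iic_principalSolution_split hL hγ hK hξ ht, map_smul, ← smul_add]

theorem memLp_two_exp_decay (hγ : 0 < γ) (t : ℝ) :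
    MemLp (fun s => Real.exp (-(γ / 2) * (t - s))) 2 (volume.restrict (Set.Iic t)) := by
  refine (memLp_two_iff_integrable_sq (Continuous.aestronglyMeasurable (by fun_prop))).2 ?_
  refine (integrableOn_exp_decay hγ t).congr (.of_forall fun s => ?_)
  simp only [← Real.exp_nat_mul]
  ring_nf

/-- Controls need not be square integrable on `(-∞,t]`. Half of the decay is therefore moved onto
them: with `w(s) = e^{-γ(t-s)/2}`, `Ψξ = (w⁻¹Ψ)(wξ)`, and both factors are in `L²` because `‖w⁻¹Ψ‖ ≤
Kw`. -/
theorem isCompact_attractor (hL : LocallyIntegrable L volume) (hγ : 0 < γ)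
    (hK : ∀ s t : ℝ, s ≤ t → ‖principalSolution L t s‖ ≤ K * Real.exp (-γ * (t - s)))
    (t : ℝ) : IsCompact (attractor L ρ t) := by
  set w : ℝ → ℝ := fun s => Real.exp (-(γ / 2) * (t - s)) with hw
  have hwpos (s : ℝ) : 0 < w s := Real.exp_pos _
  have hwc : Continuous w := by fun_prop
  have hw2 : MemLp w 2 (volume.restrict (Set.Iic t)) := memLp_two_exp_decay hγ t
  set κ : ℝ → Op d := fun s => (w s)⁻¹ • principalSolution L t s with hκ
  have hκ2 : MemLp κ 2 (volume.restrict (Set.Iic t)) := by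
    refine (hw2.const_mul K).of_le ((hwc.inv₀ fun s => (hwpos s).ne').smul
      (continuous_principalSolution_right hL t)).aestronglyMeasurable ?_
    filter_upwards [ae_restrict_mem measurableSet_Iic] with s hs
    have hsq : Real.exp (-γ * (t - s)) = w s * w s := by
      rw [hw, ← Real.exp_add]; ring_nf
    rw [hκ, norm_smul, norm_inv, Real.norm_of_nonneg (hwpos s).le]
    calc _ ≤ (w s)⁻¹ * (K * (w s * w s)) := by
          have := hK s t hs
          rw [hsq] at this
          have := hwpos s
          gcongr
      _ = K * w s := by have := hwpos s; field_simp
      _ ≤ _ := le_abs_self _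
  have heq : attractor L ρ t = (fun x => ρ • x) '' {x : E d | ∃ η : ℝ → E d,
      AEStronglyMeasurable η (volume.restrict (Set.Iic t)) ∧
      (∀ᵐ s ∂(volume.restrict (Set.Iic t)), ‖η s‖ ≤ w s) ∧ x = ∫ s in Set.Iic t, κ s (η s)} := by
    ext x
    constructor
    · rintro ⟨ξ, hξ, rfl⟩
      rw [mem_controls_iff] at hξ
      refine ⟨_, ⟨fun s => w s • ξ s, hwc.aestronglyMeasurable.smul hξ.1.restrict, ?_, ?_⟩, rfl⟩
      · filter_upwards [ae_restrict_of_ae hξ.2] with s hs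
        rw [norm_smul, Real.norm_of_nonneg (hwpos s).le]
        exact mul_le_of_le_one_right (hwpos s).le hs
      · refine integral_congr_ae (.of_forall fun s => ?_)
        simp [hκ, smul_smul, (hwpos s).ne']
    · rintro ⟨_, ⟨η, hm, hle, rfl⟩, rfl⟩
      -- Values after time `t` do not matter; zero keeps the control admissible.
      refine ⟨(Set.Iic t).indicator fun s => (w s)⁻¹ • η s, mem_controls_iff.2 ⟨?_, ?_⟩, ?_⟩
      · rw [aestronglyMeasurable_indicator_iff measurableSet_Iic]
        exact (hwc.inv₀ fun s => (hwpos s).ne').aestronglyMeasurable.smul hm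
      · filter_upwards [(ae_restrict_iff' measurableSet_Iic).1 hle] with s hs
        by_cases hst : s ∈ Set.Iic t
        · rw [Set.indicator_of_mem hst, norm_smul, norm_inv, Real.norm_of_nonneg (hwpos s).le,
            inv_mul_le_one₀ (hwpos s)]
          exact hs hst
        · simp [Set.indicator_of_notMem hst]
      · congr 1
        refine setIntegral_congr_fun measurableSet_Iic fun s hs => ?_
        simp only [Set.indicator_of_mem hs]
        simp [hκ]
  rw [heq]
  exact (isCompact_setOf_integral hκ2 hw2).image (continuous_const_smul ρ)

theorem isInvariant_attractor (hL : LocallyIntegrable L volume) (hγ : 0 < γ)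
    (hK : ∀ s t : ℝ, s ≤ t → ‖principalSolution L t s‖ ≤ K * Real.exp (-γ * (t - s))) :
    IsInvariant L ρ (attractor L ρ) :=
  ⟨attractor_nonempty, isCompact_attractor hL hγ hK,
    fun _ _ ht => evolution_attractor hL hγ hK ht.le⟩

/-- Any point of `N` will do: steering it by the control of `y` cancels the forcing terms. -/
theorem exists_mem_evolution_edist_le (hL : LocallyIntegrable L volume)
    (hK : ∀ s t : ℝ, s ≤ t → ‖principalSolution L t s‖ ≤ K * Real.exp (-γ * (t - s)))
    {t₀ t R : ℝ} (ht : t₀ ≤ t) {M N : Set (E d)} (hN : N.Nonempty)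
    (hMR : ∀ x ∈ M, ‖x‖ ≤ R) (hNR : ∀ x ∈ N, ‖x‖ ≤ R) {y : E d} (hy : y ∈ evolution L ρ t t₀ M) :
    ∃ z ∈ evolution L ρ t t₀ N,
      edist y z ≤ ENNReal.ofReal (K * Real.exp (-γ * (t - t₀)) * (R + R)) := by
  obtain ⟨x, hx, ξ, hξ, rfl⟩ := (mem_evolution_iff hL).1 hy
  obtain ⟨x', hx'⟩ := hN
  refine ⟨_, (mem_evolution_iff hL).2 ⟨x', hx', ξ, hξ, rfl⟩, ?_⟩
  rw [edist_dist]
  refine ENNReal.ofReal_le_ofReal ?_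
  rw [dist_add_right, dist_eq_norm, ← map_sub]
  refine (ContinuousLinearMap.le_opNorm _ _).trans ?_
  exact mul_le_mul (hK t₀ t ht) ((norm_sub_le _ _).trans (add_le_add (hMR x hx) (hNR x' hx')))
    (norm_nonneg _) ((norm_nonneg _).trans (hK t₀ t ht))

theorem hausdorffEDist_evolution_le (hL : LocallyIntegrable L volume)
    (hK : ∀ s t : ℝ, s ≤ t → ‖principalSolution L t s‖ ≤ K * Real.exp (-γ * (t - s)))
    {t₀ t R : ℝ} (ht : t₀ ≤ t) {M N : Set (E d)} (hM : M.Nonempty) (hN : N.Nonempty)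
    (hMR : ∀ x ∈ M, ‖x‖ ≤ R) (hNR : ∀ x ∈ N, ‖x‖ ≤ R) :
    Metric.hausdorffEDist (evolution L ρ t t₀ M) (evolution L ρ t t₀ N) ≤
      ENNReal.ofReal (K * Real.exp (-γ * (t - t₀)) * (R + R)) :=
  Metric.hausdorffEDist_le_of_mem_edist
    (fun _ hy => exists_mem_evolution_edist_le hL hK ht hN hMR hNR hy)
    (fun _ hy => exists_mem_evolution_edist_le hL hK ht hM hNR hMR hy)

theorem tendsto_ofReal_exp_decay {ι : Type*} {l : Filter ι} {u : ι → ℝ} (hγ : 0 < γ)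
    (hu : Tendsto u l atTop) (K R : ℝ) :
    Tendsto (fun i => ENNReal.ofReal (K * Real.exp (-γ * u i) * R)) l (𝓝 0) := by
  have h1 : Tendsto (fun i => Real.exp (-γ * u i)) l (𝓝 0) :=
    Real.tendsto_exp_atBot.comp (hu.const_mul_atTop_of_neg (neg_neg_of_pos hγ))
  have h2 : Tendsto (fun i => K * Real.exp (-γ * u i) * R) l (𝓝 0) := by
    simpa using (h1.const_mul K).mul_const R
  simpa using ENNReal.tendsto_ofReal h2

/-- Both fibres at `t` are images of fibres at an arbitrarily early `t₀` in one fixed ball, so their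
distance is zero; being closed, they coincide. -/
theorem eq_attractor_of_isInvariant (hL : LocallyIntegrable L volume) (hρ : 0 < ρ) (hγ : 0 < γ)
    (hK : ∀ s t : ℝ, s ≤ t → ‖principalSolution L t s‖ ≤ K * Real.exp (-γ * (t - s)))
    {S : ℝ → Set (E d)} (hS : IsInvariant L ρ S) (hb : UniformlyBounded S) :
    S = attractor L ρ := by
  obtain ⟨r, -, hr⟩ := hb
  obtain ⟨r', -, hr'⟩ := uniformlyBounded_attractor hρ hγ hK
  have hA := isInvariant_attractor (ρ := ρ) hL hγ hK
  funext t
  refine ((hS.2.1 t).isClosed.hausdorffEDist_zero_iff (hA.2.1 t).isClosed).1 ?_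
  refine le_antisymm (ge_of_tendsto (tendsto_ofReal_exp_decay hγ
    (tendsto_atTop_add_const_left atBot t tendsto_neg_atBot_atTop) K
    (max r r' + max r r')) ?_) zero_le
  filter_upwards [eventually_lt_atBot t] with t₀ ht
  rw [← hS.2.2 t₀ t ht, ← hA.2.2 t₀ t ht, ← sub_eq_add_neg]
  exact hausdorffEDist_evolution_le hL hK ht.le (hS.1 t₀) (hA.1 t₀)
    (fun x hx => (mem_ball_zero_iff.1 (hr t₀ hx)).le.trans (le_max_left _ _))
    (fun x hx => (mem_ball_zero_iff.1 (hr' t₀ hx)).le.trans (le_max_right _ _))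

/-- An invariant subfamily inherits the uniform bound, so it equals the attractor. -/
theorem isMinimalInvariant_attractor (hL : LocallyIntegrable L volume) (hρ : 0 < ρ) (hγ : 0 < γ)
    (hK : ∀ s t : ℝ, s ≤ t → ‖principalSolution L t s‖ ≤ K * Real.exp (-γ * (t - s))) :
    IsMinimalInvariant L ρ (attractor L ρ) := by
  refine ⟨isInvariant_attractor hL hγ hK, fun S hS hSA => ?_⟩
  obtain ⟨r, hr0, hr⟩ := uniformlyBounded_attractor (L := L) hρ hγ hK
  exact eq_attractor_of_isInvariant hL hρ hγ hK hS ⟨r, hr0, fun t => (hSA t).trans (hr t)⟩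

/-- `R` depends on neither `t₀` nor `t`, so one estimate serves both the pullback and the forward
limit. -/
theorem exists_hausdorffEDist_evolution_attractor_le (hL : LocallyIntegrable L volume)
    (hρ : 0 < ρ) (hγ : 0 < γ)
    (hK : ∀ s t : ℝ, s ≤ t → ‖principalSolution L t s‖ ≤ K * Real.exp (-γ * (t - s)))
    {C : Set (E d)} (hC : IsCompact C) (hne : C.Nonempty) :
    ∃ R : ℝ, ∀ t₀ t, t₀ ≤ t →
      Metric.hausdorffEDist (evolution L ρ t t₀ C) (attractor L ρ t) ≤
        ENNReal.ofReal (K * Real.exp (-γ * (t - t₀)) * R) := by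
  obtain ⟨r, hr⟩ := hC.isBounded.exists_norm_le
  obtain ⟨r', -, hr'⟩ := uniformlyBounded_attractor (L := L) hρ hγ hK
  refine ⟨max r r' + max r r', fun t₀ t ht => ?_⟩
  rw [← evolution_attractor hL hγ hK ht]
  exact hausdorffEDist_evolution_le hL hK ht hne (attractor_nonempty t₀)
    (fun x hx => (hr x hx).trans (le_max_left _ _))
    (fun x hx => (mem_ball_zero_iff.1 (hr' t₀ hx)).le.trans (le_max_right _ _))

end Stable

end LinearInclusion

end

theorem theorem4p2 (d : ℕ) (L : ℝ → LinearInclusion.Op d) (hL : LocallyIntegrable L volume)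
    (ρ : ℝ) (hρ : 0 < ρ) (hstab : LinearInclusion.ExponentiallyStable L) :
    -- the integrals that define the fibres converge
    (∀ t : ℝ, ∀ ξ ∈ LinearInclusion.controls d,
      IntegrableOn (fun s => LinearInclusion.principalSolution L t s (ξ s)) (Set.Iic t) volume) ∧
    LinearInclusion.UniformlyBounded (LinearInclusion.attractor L ρ) ∧
    LinearInclusion.IsMinimalInvariant L ρ (LinearInclusion.attractor L ρ) ∧
    -- uniqueness
    (∀ M : ℝ → Set (LinearInclusion.E d), LinearInclusion.UniformlyBounded M →
      LinearInclusion.IsMinimalInvariant L ρ M → M = LinearInclusion.attractor L ρ) ∧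
    -- pullback and forward attraction
    (∀ K : Set (LinearInclusion.E d), IsCompact K → K.Nonempty →
      (∀ t : ℝ, Tendsto (fun t₀ => Metric.hausdorffEDist (LinearInclusion.evolution L ρ t t₀ K)
        (LinearInclusion.attractor L ρ t)) atBot (𝓝 0)) ∧
      (∀ t₀ : ℝ, Tendsto (fun t => Metric.hausdorffEDist (LinearInclusion.evolution L ρ t t₀ K)
        (LinearInclusion.attractor L ρ t)) atTop (𝓝 0))) := by
  obtain ⟨K, γ, -, hγ, hK⟩ := hstab
  refine ⟨fun t ξ hξ => LinearInclusion.integrableOn_principalSolution_apply hL hγ hK hξ t,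
    LinearInclusion.uniformlyBounded_attractor hρ hγ hK,
    LinearInclusion.isMinimalInvariant_attractor hL hρ hγ hK,
    fun M hb hM => LinearInclusion.eq_attractor_of_isInvariant hL hρ hγ hK hM.1 hb,
    fun C hC hne => ?_⟩
  obtain ⟨R, hR⟩ :=
    LinearInclusion.exists_hausdorffEDist_evolution_attractor_le hL hρ hγ hK hC hne
  refine ⟨fun t => ?_, fun t₀ => ?_⟩
  · have hu : Tendsto (fun t₀ : ℝ => t - t₀) atBot atTop :=
      tendsto_atTop_add_const_left atBot t tendsto_neg_atBot_atTop
    refine tendsto_of_tendsto_of_tendsto_of_le_of_le' tendsto_const_nhds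
      (LinearInclusion.tendsto_ofReal_exp_decay hγ hu K R) (.of_forall fun _ => zero_le) ?_
    filter_upwards [eventually_le_atBot t] with t₀ ht
    exact hR t₀ t ht
  · have hu : Tendsto (fun t : ℝ => t - t₀) atTop atTop :=
      tendsto_atTop_add_const_right atTop (-t₀) tendsto_id
    refine tendsto_of_tendsto_of_tendsto_of_le_of_le' tendsto_const_nhds
      (LinearInclusion.tendsto_ofReal_exp_decay hγ hu K R) (.of_forall fun _ => zero_le) ?_
    filter_upwards [eventually_ge_atTop t₀] with t ht
    exact hR t₀ t ht
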